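/- Fix $N\ge 2$ parties. The \emph{original network} has one device per party and, for each $i\in\{1,\dots,N\}$, one $(N-1)$-way resource $S_i$ shared by all the parties other than $i$; on its input, the device of party $j$ acts locally on its shares of all the $S_i$, $i\ne j$, and produces an output. A \emph{setup} (nonfanout inflation) is a finite collection of copies of the devices, in which each copy of the device of party $j$ receives, for each $i\neq j$, its share of one copy of $S_i$, and each copy of $S_i$ has only one share for each party other than $i$, hence serves at most one copy of the device of each such party (some shares may be left unmeasured). Two subsets of devices of two setups are \emph{identical} if a bijection between them preserves the parties and, for each $i$, preserves which devices receive shares of a common copy of $S_i$. A correlation $P(a_1\dots a_N|x_1\dots x_N)$ with finitely many outputs is obtainable by local operations over $(N-1)$-way theory-agnostic (GPT) resources along with randomness shared by all parties if no setup $I$ leads to a contradiction, i.e. if for every setup $I$ there are a random variable $\lambda$ and, for each value of $\lambda$, conditional distributions $p_\lambda$ of the outputs given the inputs for the original network and $q_\lambda$ for $I$, measurable in $\lambda$, such that $P(a|x)=\mathbb E_\lambda\,p_\lambda(a|x)$ and, for each fixed $\lambda$: (i) identical subsets of devices, both in the original network, both in $I$, or one in each, have the same marginal conditional distribution when given the same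 inputs, regardless of the inputs of the other devices; (ii) within the original network and within $I$, the outputs of two subsets of devices having no device and no copy of a resource in common are independent. A nonsignalling correlation $P$ is \emph{genuinely LOSR $N$-partite nonlocal} if it is not obtainable in this way. Let $|\mathrm{GHZ}_N\rangle=(|0\rangle^{\otimes N}+|1\rangle^{\otimes N})/\sqrt2$. \textbf{Proposition.} For every $N\ge 2$ there are finite sets of inputs and of outputs and, for each party and each input, a measurement (POVM) on one qubit such that the correlation obtained when each of the $N$ parties applies its measurements to its own qubit of the state $|\mathrm{GHZ}_N\rangle$ is (nonsignalling and) genuinely LOSR $N$-partite nonlocal. -/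

import Mathlib

open scoped ComplexOrder

/-! ## Quantum correlations -/

/-- The state `|GHZ_N⟩ = (|0…0⟩ + |1…1⟩)/√2` of `N` qubits, in the computational basis, which is
indexed by the bit strings `Fin N → Fin 2`. -/
noncomputable def ghzState (N : ℕ) : (Fin N → Fin 2) → ℂ :=
  ((Real.sqrt 2 : ℝ) : ℂ)⁻¹ • (Pi.single (fun _ => 0) 1 + Pi.single (fun _ => 1) 1)

/-- A measurement (POVM) on one qubit with outcomes in `O`. -/
structure QubitMeasurement (O : Type) [Fintype O] where
  effect : O → Matrix (Fin 2) (Fin 2) ℂ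
  posSemidef : ∀ o, (effect o).PosSemidef
  sum_effect : ∑ o, effect o = 1

/-- The tensor product of `N` one-qubit operators, as a matrix in the computational basis. -/
def tensorOperator {N : ℕ} (A : Fin N → Matrix (Fin 2) (Fin 2) ℂ) :
    Matrix (Fin N → Fin 2) (Fin N → Fin 2) ℂ :=
  Matrix.of fun s t => ∏ j, A j (s j) (t j)

/-- A candidate behaviour `p(a|x)`, written `p x a`, of `n` devices with inputs in `X` and outputs
in `O`. -/
abbrev Behavior (n : ℕ) (X O : Type) : Type := (Fin n → X) → (Fin n → O) → ℝ

/-- Born's rule: the probabilities `⟨ψ| M_{1,x₁}^{a₁} ⊗ ⋯ ⊗ M_{N,x_N}^{a_N} |ψ⟩` obtained when the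
`j`-th of `N` parties, on input `x j`, performs the measurement `M j (x j)` on the `j`-th qubit. -/
noncomputable def quantumBehavior {N : ℕ} {X O : Type} [Fintype O]
    (ψ : (Fin N → Fin 2) → ℂ) (M : Fin N → X → QubitMeasurement O) : Behavior N X O :=
  fun x a =>
    (star ψ ⬝ᵥ (tensorOperator (fun j => (M j (x j)).effect (a j))).mulVec ψ).re

/-! ## Behaviours and their marginals -/

section Behaviors

variable {X O : Type} [Fintype O] [DecidableEq O]

/-- For each choice of inputs, `p` is a probability distribution of the outputs. -/
def IsStochastic {n : ℕ} (p : Behavior n X O) : Prop :=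
  ∀ x, (∀ a, 0 ≤ p x a) ∧ ∑ a, p x a = 1

/-- The distribution of the outputs of the devices `f 0, …, f (k - 1)` when the outputs of all
the devices are distributed according to `q`. -/
def marginal {n k : ℕ} (q : (Fin n → O) → ℝ) (f : Fin k → Fin n) : (Fin k → O) → ℝ :=
  fun b => ∑ a with a ∘ f = b, q a

/-- The joint distribution of the outputs of the devices `f 0, …, f (k - 1)` and of the outputs of
the devices `g 0, …, g (l - 1)`. -/
def jointMarginal {n k l : ℕ} (q : (Fin n → O) → ℝ) (f : Fin k → Fin n) (g : Fin l → Fin n) :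
    (Fin k → O) → (Fin l → O) → ℝ :=
  fun b c => ∑ a with a ∘ f = b ∧ a ∘ g = c, q a

/-- A nonsignalling correlation: the outputs of each subset of the parties depend only on the
inputs of this subset. -/
def IsNonsignallingCorrelation {n : ℕ} (p : Behavior n X O) : Prop :=
  IsStochastic p ∧
    ∀ (k : ℕ) (f : Fin k ↪ Fin n) (x y : Fin n → X), x ∘ f = y ∘ f →
      marginal (p x) f = marginal (p y) f

end Behaviors

/-! ## Networks of `(N - 1)`-way resources and their nonfanout inflations

In the original network of `N` parties there is, for each `i : Fin N`, one resource of type `i`,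
which is shared by all the parties except party `i`: these are the `N` possible
`(N - 1)`-way resources. The device of party `j` acts jointly on its shares of the resources of
all the types `i ≠ j`. -/

/-- A setup built from finitely many independent copies of the devices of the `N` parties and of
the resources of the network. The device `v` is a copy of the device of party `party v`, and
`source v i` is the label of the copy of the resource of type `i` of which `v` receives a share
(meaningful only if `i ≠ party v`). A copy of a resource has only one share for
each party it serves, so it serves at most one copy of the device of each party; shares
that are sent to no device are left unmeasured. -/
structure Setup (N : ℕ) where
  size : ℕ
  party : Fin size → Fin N
  source : Fin size → Fin N → ℕ
  nonfanout : ∀ v w i, party v = party w → i ≠ party v → source v i = source w i → v = w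

namespace Setup

variable {N : ℕ}

/-- The original network: one device per party and one copy of each resource. -/
def original (N : ℕ) : Setup N where
  size := N
  party := id
  source := fun _ _ => 0
  nonfanout := fun _ _ _ h _ _ => h

/-- The devices `v` and `w` receive shares of the same copy of the resource of type `i`. -/
def Shares (S : Setup N) (i : Fin N) (v w : Fin S.size) : Prop :=
  i ≠ S.party v ∧ i ≠ S.party w ∧ S.source v i = S.source w i

/-- The devices `f 0, …, f (k - 1)` of `S` and `g 0, …, g (k - 1)` of `T` form identical subsets:
they are copies of the devices of the same parties, connected to resources in the same way. -/
def Identical (S T : Setup N) {k : ℕ} (f : Fin k ↪ Fin S.size) (g : Fin k ↪ Fin T.size) : Prop :=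
  (∀ c, S.party (f c) = T.party (g c)) ∧
    ∀ c d i, S.Shares i (f c) (f d) ↔ T.Shares i (g c) (g d)

/-- The two subsets of devices have neither a device nor a resource in common. -/
def Separated (S : Setup N) {k l : ℕ} (f : Fin k ↪ Fin S.size) (g : Fin l ↪ Fin S.size) : Prop :=
  ∀ c d, f c ≠ g d ∧ ∀ i, ¬ S.Shares i (f c) (g d)

variable {X O : Type} [Fintype O] [DecidableEq O]

/-- Causality: identical subsets of `S` and of `T`, on identical inputs, behave identically. -/
def SameBehavior (S T : Setup N) (p : Behavior S.size X O) (q : Behavior T.size X O) : Prop :=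
  ∀ (k : ℕ) (f : Fin k ↪ Fin S.size) (g : Fin k ↪ Fin T.size), S.Identical T f g →
    ∀ (x : Fin S.size → X) (y : Fin T.size → X), x ∘ f = y ∘ g →
      marginal (p x) f = marginal (q y) g

/-- The outputs of separated subsets of devices are independent. -/
def Factorizes (S : Setup N) (p : Behavior S.size X O) : Prop :=
  ∀ (k l : ℕ) (f : Fin k ↪ Fin S.size) (g : Fin l ↪ Fin S.size), S.Separated f g →
    ∀ x b c, jointMarginal (p x) f g b c = marginal (p x) f b * marginal (p x) g c

end Setup

section Nonlocality

variable {N : ℕ} {X O : Type} [Fintype O] [DecidableEq O]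

/-- For one fixed value of the shared randomness, the behaviour `p` of the original network and
the behaviour `q` of the inflated setup `I` obey device replication and causality: they are
probability distributions, identical subsets of these two setups behave identically, and
separated subsets of a setup are independent. -/
def IsCausalPair (I : Setup N) (p : Behavior N X O) (q : Behavior I.size X O) : Prop :=
  IsStochastic p ∧ IsStochastic q ∧
    (Setup.original N).SameBehavior (Setup.original N) p p ∧
    (Setup.original N).SameBehavior I p q ∧
    I.SameBehavior I q q ∧
    (Setup.original N).Factorizes p ∧ I.Factorizes q

/-- `P` can be obtained by local operations over (theory-agnostic) `(N - 1)`-way resources along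
with randomness `r` shared by all the parties: no inflated setup `I` leads to a contradiction,
that is, in each of them the correlation `P` is the average over the shared randomness of
behaviours of the original network that are causally consistent with behaviours of `I`, the
same value of the shared randomness being distributed to all the devices. -/
def IsLOSRRealizable (P : Behavior N X O) : Prop :=
  ∀ I : Setup N,
    ∃ (R : Type) (_ : MeasurableSpace R) (μ : MeasureTheory.Measure R)
      (p : R → Behavior N X O) (q : R → Behavior I.size X O),
      MeasureTheory.IsProbabilityMeasure μ ∧
      (∀ x a, Measurable fun r => p r x a) ∧
      (∀ x a, Measurable fun r => q r x a) ∧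
      (∀ r, IsCausalPair I (p r) (q r)) ∧
      ∀ x a, P x a = ∫ r, p r x a ∂μ

/-- `P` is a nonsignalling correlation of `N` parties that is genuinely LOSR `N`-partite
nonlocal. -/
def IsGenuinelyLOSRNonlocal (P : Behavior N X O) : Prop :=
  IsNonsignallingCorrelation P ∧ ¬ IsLOSRRealizable P

end Nonlocality

open Finset

/-! ## Marginals -/

section Marginals

variable {X O : Type} [Fintype O] [DecidableEq O]

/-! Cut every resource `i` into one copy for the parties before `i` and one for those after.
Neighbours on the line see no difference, but the two ends no longer share anything. When all
parties measure `Z`, GHZ outputs agree perfectly; this passes along the line neighbour by neighbour,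
so the ends agree while being independent. For almost every value of the shared randomness, the
first party's `Z` output is thus a constant (`exists_output_of_isCausalPair_chain`). Nonsignalling
then bounds a CHSH-type expression by 2 (`bellValue_le_two`), whereas GHZ reaches 14/5
(`bellValue_ghzBehavior`). -/

theorem marginal_eq_zero {n k : ℕ} {q : (Fin n → O) → ℝ} {f : Fin k → Fin n} {b : Fin k → O}
    (h : ∀ a, a ∘ f = b → q a = 0) : marginal q f b = 0 :=
  sum_eq_zero fun a ha => h a (mem_filter.1 ha).2

theorem eq_zero_of_marginal_eq_zero {n k : ℕ} {q : (Fin n → O) → ℝ} (hq : ∀ a, 0 ≤ q a)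
    {f : Fin k → Fin n} {b : Fin k → O} (h : marginal q f b = 0) {a : Fin n → O}
    (ha : a ∘ f = b) : q a = 0 :=
  (sum_eq_zero_iff_of_nonneg fun a _ => hq a).1 h a (mem_filter.2 ⟨mem_univ a, ha⟩)

theorem sum_mul_comp_eq_sum_marginal {n k : ℕ} (q : (Fin n → O) → ℝ) (f : Fin k → Fin n)
    (F : (Fin k → O) → ℝ) : ∑ a, q a * F (a ∘ f) = ∑ b, marginal q f b * F b := by
  rw [← sum_fiberwise univ (fun a : Fin n → O => a ∘ f)]
  refine sum_congr rfl fun b _ => ?_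
  rw [marginal, sum_mul]
  exact sum_congr rfl fun a ha => by rw [(mem_filter.1 ha).2]

theorem sum_mul_comp_congr {n k m : ℕ} {p : (Fin n → O) → ℝ} {q : (Fin m → O) → ℝ}
    {f : Fin k → Fin n} {g : Fin k → Fin m} (h : marginal p f = marginal q g)
    (F : (Fin k → O) → ℝ) : ∑ a, p a * F (a ∘ f) = ∑ a, q a * F (a ∘ g) := by
  rw [sum_mul_comp_eq_sum_marginal, sum_mul_comp_eq_sum_marginal, h]

end Marginals

/-- The one-element family of devices `v`. -/
def singleDevice {n : ℕ} (v : Fin n) : Fin 1 ↪ Fin n :=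
  ⟨fun _ => v, Function.injective_of_subsingleton _⟩

/-- The two neighbouring devices `t` and `t + 1`. -/
def adjacentDevices {n : ℕ} (t : Fin n) : Fin 2 ↪ Fin (n + 1) :=
  ⟨![t.castSucc, t.succ], by
    have h := (Fin.castSucc_lt_succ (i := t)).ne
    intro c d
    fin_cases c <;> fin_cases d <;> simp [h, h.symm]⟩

/-! ## The chain inflation -/

namespace Setup

theorem identical_refl {N k : ℕ} (S : Setup N) (f : Fin k ↪ Fin S.size) : S.Identical S f f :=
  ⟨fun _ => rfl, fun _ _ _ => Iff.rfl⟩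

/-- One device per party, arranged in a line; the resource of type `i` is replaced by two copies,
one for the parties before `i` and one for the parties after `i`. -/
def chain (N : ℕ) : Setup N where
  size := N
  party := id
  source := fun v i => if v < i then 0 else 1
  nonfanout := fun _ _ _ h _ _ => h

/-- No `i` lies strictly between two positions that differ by at most one, so no cut separates them.
-/
theorem identical_original_chain {N k : ℕ} (f : Fin k ↪ Fin N)
    (hf : ∀ c d, (f c : ℕ) ≤ f d + 1) : (original N).Identical (chain N) f f := by
  refine ⟨fun _ => rfl, fun c d i => ?_⟩
  have h₁ := hf c d
  have h₂ := hf d c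
  simp only [Shares, original, chain, id, Fin.lt_def, ne_eq, Fin.ext_iff]
  split_ifs <;> simp <;> omega

/-- A resource serving both ends would have its index strictly between them, and is cut there. -/
theorem separated_chain_ends (n : ℕ) :
    (chain (n + 2)).Separated (singleDevice (0 : Fin (n + 2)))
      (singleDevice (Fin.last (n + 1))) := by
  intro c d
  refine ⟨fun h => ?_, fun i h => ?_⟩
  · exact (Fin.last_pos (n := n)).ne h
  · obtain ⟨h₀, -, h⟩ := h
    have h₀ : i ≠ 0 := h₀
    have h : (if (0 : Fin (n + 2)) < i then 0 else 1)
      = if Fin.last (n + 1) < i then 0 else 1 := h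
    simp [Fin.pos_iff_ne_zero, h₀, Fin.not_lt.2 (Fin.le_last i)] at h

/-- If the outputs of all the parties are perfectly correlated on the inputs `x`, then causal
consistency with the chain inflation forces the output of the first party to be constant. -/
theorem exists_output_of_isCausalPair_chain {n : ℕ} {X : Type}
    {p : Behavior (n + 2) X (Fin 2)} {q : Behavior (n + 2) X (Fin 2)}
    (h : IsCausalPair (chain (n + 2)) p q) (x : Fin (n + 2) → X)
    (hx : ∀ a, (∃ i j, a i ≠ a j) → p x a = 0) :
    ∃ s, ∀ y a, y 0 = x 0 → a 0 ≠ s → p y a = 0 := by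
  obtain ⟨hp, hq, -, hpq, -, -, hfac⟩ := h
  have hadj : ∀ (a : Fin (n + 2) → Fin 2) (t : Fin (n + 1)),
      a t.castSucc ≠ a t.succ → q x a = 0 := by
    intro a t hat
    refine eq_zero_of_marginal_eq_zero (hq x).1 (f := adjacentDevices t) ?_ rfl
    have hm := hpq 2 (adjacentDevices t) (adjacentDevices t)
      (identical_original_chain _ ?_) x x rfl
    · refine (congrFun hm _).symm.trans
        (marginal_eq_zero fun b hb => hx b ⟨t.castSucc, t.succ, ?_⟩)
      have h₀ : b t.castSucc = a t.castSucc := congrFun hb 0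
      have h₁ : b t.succ = a t.succ := congrFun hb 1
      rwa [h₀, h₁]
    · intro c d
      have h : ∀ c, (adjacentDevices t c : ℕ) = t + c := fun c => by
        fin_cases c <;> rfl
      rw [h, h]
      omega
  have hends : ∀ a : Fin (n + 2) → Fin 2, a (Fin.last (n + 1)) ≠ a 0 → q x a = 0 := by
    intro a ha
    by_contra hne
    refine ha (Fin.induction (motive := fun j => a j = a 0) rfl (fun t ht => ?_) _)
    by_contra hat
    exact hne (hadj a t fun h => hat (h ▸ ht))
  have hprod := hfac 1 1 _ _ (separated_chain_ends n) x (fun _ => 0) (fun _ => 1)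
  have hjoint : jointMarginal (q x) (singleDevice (0 : Fin (n + 2)))
      (singleDevice (Fin.last (n + 1))) (fun _ => 0) (fun _ => 1) = 0 := by
    refine sum_eq_zero fun a ha => hends a ?_
    obtain ⟨-, h₀, h₁⟩ := mem_filter.1 ha
    have h₀ : a 0 = 0 := congrFun h₀ 0
    have h₁ : a (Fin.last (n + 1)) = 1 := congrFun h₁ 0
    simp [h₀, h₁]
  -- Independence turns P(first = 0, last = 1) = 0 into a product, one factor of which vanishes.
  have hq₀ : ∃ s, ∀ a, a 0 ≠ s → q x a = 0 := by
    rcases mul_eq_zero.1 (hprod.symm.trans hjoint) with h | h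
    · refine ⟨1, fun a ha => eq_zero_of_marginal_eq_zero (hq x).1 h (funext fun _ => ?_)⟩
      change a 0 = 0
      omega
    · refine ⟨0, fun a ha => ?_⟩
      by_cases hl : a (Fin.last (n + 1)) = a 0
      · refine eq_zero_of_marginal_eq_zero (hq x).1 h (funext fun _ => ?_)
        change a (Fin.last (n + 1)) = 1
        omega
      · exact hends a hl
  obtain ⟨s, hs⟩ := hq₀
  refine ⟨s, fun y a hy ha => ?_⟩
  refine eq_zero_of_marginal_eq_zero (hp y).1 (f := singleDevice (0 : Fin (n + 2))) ?_ rfl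
  have hm := hpq 1 (singleDevice (0 : Fin (n + 2))) (singleDevice (0 : Fin (n + 2)))
    (identical_original_chain _ fun _ _ => Nat.le_succ _) y x (funext fun _ => hy)
  refine (congrFun hm _).trans (marginal_eq_zero fun b hb => hs b ?_)
  exact fun h => ha ((congrFun hb 0).symm.trans h)

end Setup

/-! ## A Bell expression -/

/-- The value `±1` of an output. -/
def outputSign (o : Fin 2) : ℝ := ![1, -1] o

theorem outputSign_cases (o : Fin 2) : outputSign o = 1 ∨ outputSign o = -1 := by
  fin_cases o <;> simp [outputSign]

theorem prod_outputSign_cases {n : ℕ} (b : Fin n → Fin 2) :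
    ∏ j, outputSign (b j) = 1 ∨ ∏ j, outputSign (b j) = -1 :=
  prod_induction _ (fun r : ℝ => r = 1 ∨ r = -1)
    (by rintro _ _ (rfl | rfl) (rfl | rfl) <;> norm_num) (Or.inl rfl)
    fun j _ => outputSign_cases (b j)

/-- The inputs `α` and `β` for the first two parties, and `1` for all the others. -/
def bellInput (n : ℕ) (α β : Fin 4) : Fin (n + 2) → Fin 4 :=
  Fin.cons α (Fin.cons β fun _ => 1)

/-- A CHSH-type expression, where the outputs of all the parties after the second one correct the
sign of the correlators involving the input `1` of the first party. -/
def bellValue {n : ℕ} (p : Behavior (n + 2) (Fin 4) (Fin 2)) : ℝ :=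
  ∑ a, p (bellInput n 0 2) a * (outputSign (a 0) * outputSign (a 1))
    + ∑ a, p (bellInput n 0 3) a * (outputSign (a 0) * outputSign (a 1))
    + ∑ a, p (bellInput n 1 2) a * ∏ j, outputSign (a j)
    - ∑ a, p (bellInput n 1 3) a * ∏ j, outputSign (a j)

/-- A constant output `s` can be factored out of the first two correlators, whose first input may
then be changed to 1. All four terms now come from two distributions, one for each input of the
second party. -/
theorem bellValue_le_two {n : ℕ} {p : Behavior (n + 2) (Fin 4) (Fin 2)} (hp : IsStochastic p)
    (hns : (Setup.original (n + 2)).SameBehavior (Setup.original (n + 2)) p p) {s : Fin 2}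
    (hs : ∀ y a, y 0 = 0 → a 0 ≠ s → p y a = 0) : bellValue p ≤ 2 := by
  have hA : ∀ β, ∑ a, p (bellInput n 0 β) a * (outputSign (a 0) * outputSign (a 1))
      = ∑ a, p (bellInput n 1 β) a * (outputSign s * outputSign (a 1)) := by
    intro β
    have hm := hns 1 (singleDevice (1 : Fin (n + 2))) (singleDevice (1 : Fin (n + 2)))
      (Setup.identical_refl _ _) (bellInput n 0 β) (bellInput n 1 β) (funext fun _ => rfl)
    refine Eq.trans (sum_congr rfl fun a _ => ?_)
      (sum_mul_comp_congr hm fun b => outputSign s * outputSign (b 0))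
    by_cases ha : a 0 = s
    · rw [ha]; rfl
    · have h₀ : p (bellInput n 0 β) a = 0 := hs _ a rfl ha
      exact (mul_eq_zero_of_left h₀ _).trans (mul_eq_zero_of_left h₀ _).symm
  -- The product omits the second party, so its mean cannot depend on that party's input.
  have hW : ∑ a, p (bellInput n 1 2) a * ∏ j : Fin (n + 1), outputSign (a (Fin.succAbove 1 j))
      = ∑ a, p (bellInput n 1 3) a * ∏ j : Fin (n + 1), outputSign (a (Fin.succAbove 1 j)) := by
    refine sum_mul_comp_congr (f := Fin.succAboveEmb (1 : Fin (n + 2)))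
      (g := Fin.succAboveEmb (1 : Fin (n + 2))) ?_ fun b => ∏ j, outputSign (b j)
    refine hns (n + 1) (Fin.succAboveEmb (1 : Fin (n + 2))) (Fin.succAboveEmb (1 : Fin (n + 2)))
      (Setup.identical_refl _ _) _ _ (funext fun j => ?_)
    refine Fin.cases ?_ (fun i => ?_) j
    · rfl
    · change bellInput n 1 2 (Fin.succAbove 1 i.succ) = bellInput n 1 3 (Fin.succAbove 1 i.succ)
      rw [show (1 : Fin (n + 2)) = Fin.succ 0 from rfl, Fin.succ_succAbove_succ,
        Fin.succAbove_zero]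
      rfl
  -- Pointwise, with signs `s`, `b`, `w`, this is `(1 - s b)(1 + ε s w) ≥ 0`. Adding the cases `ε =
  -- 1` and `ε = -1` cancels the means of `w`.
  have hle : ∀ (β : Fin 4) (ε : ℝ), (ε = 1 ∨ ε = -1) →
      ∑ a, p (bellInput n 1 β) a * (outputSign s * outputSign (a 1))
        + ε * ∑ a, p (bellInput n 1 β) a * ∏ j, outputSign (a j)
      ≤ 1 + ε * outputSign s * ∑ a, p (bellInput n 1 β) a
          * ∏ j : Fin (n + 1), outputSign (a (Fin.succAbove 1 j)) := by
    intro β ε hε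
    rw [← (hp (bellInput n 1 β)).2, mul_sum, mul_sum, ← sum_add_distrib, ← sum_add_distrib]
    refine sum_le_sum fun a _ => ?_
    rw [Fin.prod_univ_succAbove _ 1]
    have h₀ := (hp (bellInput n 1 β)).1 a
    have hw := prod_outputSign_cases fun j => a (Fin.succAbove 1 j)
    set w := ∏ j : Fin (n + 1), outputSign (a (Fin.succAbove 1 j))
    rcases hε with rfl | rfl <;> rcases hw with hw | hw <;>
      rcases outputSign_cases s with h₁ | h₁ <;>
      rcases outputSign_cases (a 1) with h₂ | h₂ <;> rw [hw, h₁, h₂] <;> linarith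
  have h₂ := hle 2 1 (Or.inl rfl)
  have h₃ := hle 3 (-1) (Or.inr rfl)
  rw [bellValue, hA, hA]
  rw [hW] at h₂
  linarith

/-- An average of behaviours whose Bell values are at most `2` has Bell value at most `2`. -/
theorem bellValue_le_two_of_integral {n : ℕ} {R : Type} [MeasurableSpace R]
    {μ : MeasureTheory.Measure R} [MeasureTheory.IsProbabilityMeasure μ]
    {P : Behavior (n + 2) (Fin 4) (Fin 2)} {p : R → Behavior (n + 2) (Fin 4) (Fin 2)}
    (hint : ∀ x a, MeasureTheory.Integrable (fun r => p r x a) μ)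
    (hP : ∀ x a, P x a = ∫ r, p r x a ∂μ) (hle : ∀ᵐ r ∂μ, bellValue (p r) ≤ 2) :
    bellValue P ≤ 2 := by
  have hsum : ∀ x (F : (Fin (n + 2) → Fin 2) → ℝ),
      MeasureTheory.Integrable (fun r => ∑ a, p r x a * F a) μ := fun x F =>
    MeasureTheory.integrable_finsetSum _ fun a _ => (hint x a).mul_const _
  have hsum' : ∀ x (F : (Fin (n + 2) → Fin 2) → ℝ),
      ∑ a, P x a * F a = ∫ r, ∑ a, p r x a * F a ∂μ := by
    intro x F
    rw [MeasureTheory.integral_finsetSum _ fun a _ => (hint x a).mul_const _]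
    exact sum_congr rfl fun a _ => by rw [hP, MeasureTheory.integral_mul_const]
  have h : bellValue P = ∫ r, bellValue (p r) ∂μ := by
    rw [bellValue, hsum', hsum', hsum', hsum',
      ← MeasureTheory.integral_add (hsum _ _) (hsum _ _),
      ← MeasureTheory.integral_add ?_ (hsum _ _), ← MeasureTheory.integral_sub ?_ (hsum _ _)]
    · rfl
    · exact ((hsum _ _).add (hsum _ _)).add (hsum _ _)
    · exact (hsum _ _).add (hsum _ _)
  have hi : MeasureTheory.Integrable (fun r => bellValue (p r)) μ :=
    (((hsum _ _).add (hsum _ _)).add (hsum _ _)).sub (hsum _ _)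
  rw [h]
  simpa using MeasureTheory.integral_mono_ae hi (MeasureTheory.integrable_const (2 : ℝ)) hle

theorem not_isLOSRRealizable_of_two_lt_bellValue {n : ℕ}
    {P : Behavior (n + 2) (Fin 4) (Fin 2)}
    (hcorr : ∀ a, (∃ i j, a i ≠ a j) → P (fun _ => 0) a = 0) (hbell : 2 < bellValue P) :
    ¬ IsLOSRRealizable P := by
  intro hreal
  obtain ⟨R, _, μ, p, q, _, hmeas, -, hcausal, hP⟩ := hreal (Setup.chain (n + 2))
  have hle1 : ∀ r x a, p r x a ≤ 1 := fun r x a =>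
    ((hcausal r).1 x).2 ▸ single_le_sum (fun b _ => ((hcausal r).1 x).1 b) (mem_univ a)
  have hint : ∀ x a, MeasureTheory.Integrable (fun r => p r x a) μ := fun x a =>
    MeasureTheory.Integrable.of_bound (hmeas x a).aestronglyMeasurable 1
      (Filter.Eventually.of_forall fun r => by
        rw [Real.norm_of_nonneg (((hcausal r).1 x).1 a)]
        exact hle1 r x a)
  -- A nonnegative function with zero integral vanishes almost everywhere.
  have hzero : ∀ᵐ r ∂μ, ∀ a, (∃ i j, a i ≠ a j) → p r (fun _ => 0) a = 0 := by
    refine MeasureTheory.ae_all_iff.2 fun a => ?_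
    by_cases ha : ∃ i j, a i ≠ a j
    · have h0 := (MeasureTheory.integral_eq_zero_iff_of_nonneg
        (fun r => ((hcausal r).1 (fun _ => 0)).1 a) (hint (fun _ => 0) a)).1
        ((hP _ a).symm.trans (hcorr a ha))
      filter_upwards [h0] with r hr _ using hr
    · exact Filter.Eventually.of_forall fun r h => absurd h ha
  refine hbell.not_ge (bellValue_le_two_of_integral hint hP ?_)
  filter_upwards [hzero] with r hr
  obtain ⟨s, hs⟩ := Setup.exists_output_of_isCausalPair_chain (hcausal r) (fun _ => 0) hr
  exact bellValue_le_two (hcausal r).1 (hcausal r).2.2.1 hs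

/-! ## The measurements -/

/-- The inverse of the squared norm of the vectors `effectVector x o`. -/
noncomputable def effectWeight (x : Fin 4) : ℝ := ![1, 1 / 2, 1 / 5, 1 / 5] x

/-- Unnormalised eigenvectors of `Z`, `X`, `(3 Z + 4 X) / 5` and `(3 Z - 4 X) / 5`. -/
def effectVector (x : Fin 4) (o : Fin 2) : Fin 2 → ℝ :=
  ![![![1, 0], ![0, 1]], ![![1, 1], ![1, -1]], ![![2, 1], ![1, -2]], ![![2, -1], ![1, 2]]] x o

/-- The entries of the projector on the `o`-th eigenvector of the `x`-th observable. -/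
noncomputable def effectEntry (x : Fin 4) (o u v : Fin 2) : ℝ :=
  effectWeight x * (effectVector x o u * effectVector x o v)

theorem effectWeight_nonneg (x : Fin 4) : 0 ≤ effectWeight x := by
  fin_cases x <;> norm_num [effectWeight]

theorem sum_effectEntry (x : Fin 4) (u v : Fin 2) :
    ∑ o, effectEntry x o u v = if u = v then 1 else 0 := by
  rw [Fin.sum_univ_two]
  fin_cases x <;> fin_cases u <;> fin_cases v <;>
    norm_num [effectEntry, effectWeight, effectVector]

/-- The projective measurements of `Z`, `X`, `(3 Z + 4 X) / 5` and `(3 Z - 4 X) / 5`. -/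
noncomputable def bellMeasurement (x : Fin 4) : QubitMeasurement (Fin 2) where
  effect o := Matrix.of fun u v => (effectEntry x o u v : ℂ)
  posSemidef o := by
    have h := (Matrix.posSemidef_vecMulVec_self_star
      (fun u => (effectVector x o u : ℂ))).smul
      (show (0 : ℂ) ≤ (effectWeight x : ℂ) by exact_mod_cast effectWeight_nonneg x)
    convert h using 1
    ext u v
    simp [effectEntry, Matrix.vecMulVec_apply]
  sum_effect := by
    ext u v
    rw [Matrix.sum_apply, Matrix.one_apply]
    simp only [Matrix.of_apply]
    rw [← Complex.ofReal_sum, sum_effectEntry]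
    split_ifs <;> simp

/-- The correlation of the measurements `bellMeasurement` on the GHZ state. -/
noncomputable def ghzBehavior (N : ℕ) : Behavior N (Fin 4) (Fin 2) :=
  quantumBehavior (ghzState N) fun _ => bellMeasurement

theorem ghzBehavior_apply (N : ℕ) (x : Fin N → Fin 4) (a : Fin N → Fin 2) :
    ghzBehavior N x a = 1 / 2 * ∑ u, ∑ v, ∏ j, effectEntry (x j) (a j) u v := by
  have h2 : ((Real.sqrt 2 : ℝ) : ℂ)⁻¹ * ((Real.sqrt 2 : ℝ) : ℂ)⁻¹ = ((1 / 2 : ℝ) : ℂ) := by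
    rw [← Complex.ofReal_inv, ← Complex.ofReal_mul, ← mul_inv, Real.mul_self_sqrt (by norm_num)]
    norm_num
  have hstar : star (ghzState N) = ghzState N := by
    funext s
    simp only [ghzState, Pi.star_apply, Pi.smul_apply, Pi.add_apply, Pi.single_apply, smul_eq_mul,
      star_mul', star_add, star_inv₀, Complex.star_def, Complex.conj_ofReal]
    split_ifs <;> simp
  rw [ghzBehavior, quantumBehavior, hstar, ghzState, Matrix.mulVec_smul, smul_dotProduct,
    dotProduct_smul, smul_smul, h2, Matrix.mulVec_add, dotProduct_add, add_dotProduct,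
    add_dotProduct]
  simp only [Matrix.mulVec_single_one, single_one_dotProduct, Matrix.col_apply, tensorOperator,
    bellMeasurement, Matrix.of_apply]
  simp only [← Complex.ofReal_prod, ← Complex.ofReal_add, smul_eq_mul, ← Complex.ofReal_mul,
    Complex.ofReal_re, Fin.sum_univ_two]
  ring

theorem ghzBehavior_nonneg (N : ℕ) (x : Fin N → Fin 4) (a : Fin N → Fin 2) :
    0 ≤ ghzBehavior N x a := by
  -- The effects have rank one, so the double sum over `u` and `v` is a square.
  have h : ghzBehavior N x a = 1 / 2 * ((∏ j, effectWeight (x j)) *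
      (∑ u, ∏ j, effectVector (x j) (a j) u) ^ 2) := by
    rw [ghzBehavior_apply, sq, sum_mul_sum, mul_sum]
    simp only [effectEntry, prod_mul_distrib, mul_sum]
  rw [h]
  have := prod_nonneg fun j (_ : j ∈ univ) => effectWeight_nonneg (x j)
  positivity

/-- The mean of a product of local functions of the outputs. -/
theorem sum_ghzBehavior_mul_prod (N : ℕ) (x : Fin N → Fin 4) (g : Fin N → Fin 2 → ℝ) :
    ∑ a, ghzBehavior N x a * ∏ j, g j (a j)
      = 1 / 2 * ∑ u, ∑ v, ∏ j, ∑ o, effectEntry (x j) o u v * g j o := by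
  simp only [prod_univ_sum, Fintype.piFinset_univ, ghzBehavior_apply, prod_mul_distrib]
  simp only [Fin.sum_univ_two (M := ℝ), mul_assoc, ← mul_sum, add_mul, sum_add_distrib]

theorem isNonsignallingCorrelation_ghzBehavior {N : ℕ} (hN : N ≠ 0) :
    IsNonsignallingCorrelation (ghzBehavior N) := by
  refine ⟨fun x => ⟨ghzBehavior_nonneg N x, ?_⟩, fun k f x y hxy => funext fun b => ?_⟩
  · have h := sum_ghzBehavior_mul_prod N x fun _ _ => 1
    simp only [prod_const_one, mul_one, sum_effectEntry] at h
    rw [h]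
    -- For `N = 0` the two basis strings coincide and the total would be 2.
    simp [hN]
  -- The indicator of the event is a product of local factors. Where the factor is 1, the effects
  -- sum to the identity whatever the input.
  · obtain ⟨g, hg, hmarg⟩ : ∃ g : Fin N → Fin 2 → ℝ, (∀ j, (¬ ∃ c, f c = j) → ∀ o, g j o = 1) ∧
        ∀ z, marginal (ghzBehavior N z) f b = ∑ a, ghzBehavior N z a * ∏ j, g j (a j) := by
      refine ⟨fun j o => if ∀ c, f c = j → o = b c then 1 else 0,
        fun j hj o => if_pos fun c hc => absurd ⟨c, hc⟩ hj, fun z => ?_⟩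
      rw [marginal, sum_filter]
      refine sum_congr rfl fun a _ => ?_
      rw [Fintype.prod_ite_zero]
      have : a ∘ f = b ↔ ∀ j c, f c = j → a j = b c :=
        ⟨fun h j c hj => by rw [← hj, ← h]; rfl, fun h => funext fun c => h _ c rfl⟩
      simp [this]
    rw [hmarg, hmarg, sum_ghzBehavior_mul_prod, sum_ghzBehavior_mul_prod]
    congr 1
    refine sum_congr rfl fun u _ => sum_congr rfl fun v _ => prod_congr rfl fun j _ => ?_
    by_cases hj : ∃ c, f c = j
    · obtain ⟨c, rfl⟩ := hj
      rw [show x (f c) = y (f c) from congrFun hxy c]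
    · simp only [hg j hj, mul_one, sum_effectEntry]

theorem ghzBehavior_zero_input {N : ℕ} (a : Fin N → Fin 2) (ha : ∃ i j, a i ≠ a j) :
    ghzBehavior N (fun _ => 0) a = 0 := by
  obtain ⟨i, j, hij⟩ := ha
  have hent : ∀ o u v, (o ≠ u ∨ o ≠ v) → effectEntry 0 o u v = 0 := by
    intro o u v
    fin_cases o <;> fin_cases u <;> fin_cases v <;> simp [effectEntry, effectVector]
  rw [ghzBehavior_apply]
  refine mul_eq_zero_of_right _ (sum_eq_zero fun u _ => sum_eq_zero fun v _ => ?_)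
  by_cases hi : a i = u
  · exact prod_eq_zero (mem_univ j) (hent _ _ _ (Or.inl fun hj => hij (hi.trans hj.symm)))
  · exact prod_eq_zero (mem_univ i) (hent _ _ _ (Or.inl hi))

/-- The entries of the four observables. -/
theorem sum_effectEntry_mul_outputSign (x : Fin 4) (u v : Fin 2) :
    ∑ o, effectEntry x o u v * outputSign o
      = if u = v then ![1, 0, 3 / 5, 3 / 5] x * outputSign u
        else ![0, 1, 4 / 5, -(4 / 5)] x := by
  rw [Fin.sum_univ_two]
  fin_cases x <;> fin_cases u <;> fin_cases v <;>
    norm_num [effectEntry, effectWeight, effectVector, outputSign]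

/-- `Z` keeps only the terms `u = v`, giving 3/5 twice; `X` keeps only `u ≠ v`, giving 4/5 and -4/5,
the latter subtracted. The 3-4-5 triangle keeps everything rational. -/
theorem bellValue_ghzBehavior (n : ℕ) : bellValue (ghzBehavior (n + 2)) = 14 / 5 := by
  have hpair : ∀ a : Fin (n + 2) → Fin 2, outputSign (a 0) * outputSign (a 1)
      = ∏ j, (Fin.cons outputSign (Fin.cons outputSign fun _ _ => 1) :
          Fin (n + 2) → Fin 2 → ℝ) j (a j) := by
    intro a
    simp [Fin.prod_univ_succ]
  have hall : ∀ a : Fin (n + 2) → Fin 2, ∏ j, outputSign (a j)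
      = ∏ j, (fun _ => outputSign : Fin (n + 2) → Fin 2 → ℝ) j (a j) := fun _ => rfl
  simp only [bellValue, hpair, hall, sum_ghzBehavior_mul_prod]
  simp only [Fin.prod_univ_succ, bellInput, Fin.cons_zero, Fin.cons_succ, mul_one,
    sum_effectEntry, sum_effectEntry_mul_outputSign]
  simp only [Fin.sum_univ_two, outputSign]
  simp only [Matrix.cons_val, if_true]
  simp
  norm_num

theorem proposition3 (N : ℕ) (hN : 2 ≤ N) :
    ∃ (m d : ℕ) (M : Fin N → Fin m → QubitMeasurement (Fin d)),
      IsGenuinelyLOSRNonlocal (quantumBehavior (ghzState N) M) := by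
  obtain ⟨n, rfl⟩ := Nat.exists_eq_add_of_le' hN
  refine ⟨4, 2, fun _ => bellMeasurement,
    isNonsignallingCorrelation_ghzBehavior (Nat.succ_ne_zero _),
    not_isLOSRRealizable_of_two_lt_bellValue ghzBehavior_zero_input ?_⟩
  change 2 < bellValue (ghzBehavior (n + 2))
  rw [bellValue_ghzBehavior]
  norm_num
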